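/- Let $T_1, T_2$ be locally finite trees without vertices of degree $1$. Equip each $\mathrm{Aut}(T_i)$ with the topology of pointwise convergence on the vertex set, and let $\Gamma \leq \mathrm{Aut}(T_1)\times\mathrm{Aut}(T_2)$ be a discrete subgroup acting cocompactly on $T_1\times T_2$. An anti-torus in $\Gamma$ is a pair $g_1,g_2\in\Gamma$ such that (AT1) for $i=1,2$ there are a point $p_i$ of (the geometric realization of) $T_i$ and a geodesic line $\ell_i\subset T_i$ containing $p_i$ such that $\ell_1\times\{p_2\}$ is invariant under $g_1$ and $\{p_1\}\times\ell_2$ is invariant under $g_2$; and (AT2) for all non-zero integers $m,n$ the elements $g_1^m$ and $g_2^n$ do not commute. A subgroup of $\Gamma$ is called separable if it is an intersection of finite index subgroups of $\Gamma$; virtually normal if it has a finite index subgroup that is normal in $\Gamma$; and weakly separable if it is an intersection of virtually normal subgroups of $\Gamma$. The group $\Gamma$ is called reducible if any of the following conditions holds, and irreducible if none of them holds: (i) for some $i\in\{1,2\}$ the projection of $\Gamma$ to $\mathrm{Aut}(T_i)$ is discrete; (ii) for some $i\in\{1,2\}$ there is a vertex or edge $y$ of $T_i$ whose stabilizer $\Gamma_y$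 is weakly separable in $\Gamma$; (iii) for every $i\in\{1,2\}$ and every vertex or edge $y$ of $T_i$, the stabilizer $\Gamma_y$ is separable in $\Gamma$; (iv) the groups $K_1=\{g\in\mathrm{Aut}(T_1)\mid (g,1)\in\Gamma\}$ and $K_2=\{g\in\mathrm{Aut}(T_2)\mid(1,g)\in\Gamma\}$ act cocompactly on $T_1$ and $T_2$ respectively, and $K_1\times K_2$ has finite index in $\Gamma$. If $\Gamma$ contains an anti-torus, then $\Gamma$ is irreducible. (No torsion-freeness of $\Gamma$ is assumed.) -/

import Mathlib

/-- The group of automorphisms of a graph. -/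
abbrev GraphAut {V : Type*} (G : SimpleGraph V) : Type _ := G ≃g G

/-- The topology of pointwise convergence on the vertex set (the vertex set being discrete). -/
instance GraphAut.instTopologicalSpace {V : Type*} (G : SimpleGraph V) :
    TopologicalSpace (GraphAut G) :=
  TopologicalSpace.induced (fun g : GraphAut G => (g : V → V))
    (@Pi.topologicalSpace V (fun _ => V) (fun _ => ⊥))

/-! ### The geometric realization of a graph, and geodesic lines in it -/

/-- A point of the geometric realization of the graph `G`, given by its barycentric coordinates:
a probability distribution on the vertices whose support is a vertex or an edge. -/
@[ext]
structure GeomPoint {V : Type*} (G : SimpleGraph V) where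
  coord : V → ℝ
  nonneg : ∀ v, 0 ≤ coord v
  support_simplex : ∃ a b, (a = b ∨ G.Adj a b) ∧ Function.support coord ⊆ {a, b}
  sum_eq_one : ∑ᶠ v, coord v = 1

/-- The action of a graph automorphism on the geometric realization. -/
def GraphAut.mapPoint {V : Type*} {G : SimpleGraph V} (g : GraphAut G) (x : GeomPoint G) :
    GeomPoint G where
  coord v := x.coord (g.symm v)
  nonneg v := x.nonneg _
  support_simplex := by
    obtain ⟨a, b, hab, hs⟩ := x.support_simplex
    refine ⟨g a, g b, hab.imp (congrArg g) (fun h => g.map_rel_iff.mpr h), fun v hv => ?_⟩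
    rcases hs (show g.symm v ∈ Function.support x.coord from hv) with h | h
    · exact Or.inl (by rw [← h]; exact (g.apply_symm_apply v).symm)
    · exact Or.inr (by
        rw [Set.mem_singleton_iff] at h ⊢
        rw [← h]; exact (g.apply_symm_apply v).symm)
  sum_eq_one := by
    rw [← x.sum_eq_one]
    exact finsum_comp_equiv g.symm.toEquiv

/-- `ℓ` is a geodesic line in the geometric realization of the tree `G`: the union of the edges of
a bi-infinite geodesic edge path. -/
def IsGeodesicLine {V : Type*} (G : SimpleGraph V) (ℓ : Set (GeomPoint G)) : Prop :=
  ∃ f : ℤ → V, (∀ m n : ℤ, (G.dist (f m) (f n) : ℤ) = |m - n|) ∧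
    ℓ = {x | Function.support x.coord ⊆ Set.range f}

/-! ### Cocompact actions (on locally finite graphs and products of two of them): the action has
finitely many orbits of vertices -/

/-- A group `K` of automorphisms of the locally finite graph `G` acts cocompactly. -/
def IsCocompactOn {V : Type*} {G : SimpleGraph V} (K : Subgroup (GraphAut G)) : Prop :=
  ∃ F : Set V, F.Finite ∧ ∀ v : V, ∃ g ∈ K, ∃ w ∈ F, g w = v

/-- A group `Γ` of automorphisms of the product of two locally finite graphs (preserving the
factors) acts cocompactly on the product. -/
def IsCocompactOnProd {V₁ V₂ : Type*} {T₁ : SimpleGraph V₁} {T₂ : SimpleGraph V₂}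
    (Γ : Subgroup (GraphAut T₁ × GraphAut T₂)) : Prop :=
  ∃ F : Set (V₁ × V₂), F.Finite ∧ ∀ v : V₁ × V₂, ∃ g ∈ Γ, ∃ w ∈ F, (g.1 w.1, g.2 w.2) = v

/-! ### Separability of subgroups -/

/-- A subgroup is separable if it is an intersection of finite index subgroups. -/
def Subgroup.IsSeparableSubgroup {A : Type*} [Group A] (H : Subgroup A) : Prop :=
  ∃ S : Set (Subgroup A), (∀ K ∈ S, K.FiniteIndex) ∧ H = sInf S

/-- A subgroup is virtually normal if it has a finite index subgroup which is normal in the ambient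
group. -/
def Subgroup.IsVirtuallyNormal {A : Type*} [Group A] (H : Subgroup A) : Prop :=
  ∃ N : Subgroup A, N ≤ H ∧ N.Normal ∧ (N.subgroupOf H).FiniteIndex

/-- A subgroup is weakly separable if it is an intersection of virtually normal subgroups. -/
def Subgroup.IsWeaklySeparable {A : Type*} [Group A] (H : Subgroup A) : Prop :=
  ∃ S : Set (Subgroup A), (∀ K ∈ S, K.IsVirtuallyNormal) ∧ H = sInf S

/-! ### Stabilizers of vertices and edges -/

/-- The stabilizer of a vertex in the automorphism group of a graph. -/
def GraphAut.vertexStab {V : Type*} {G : SimpleGraph V} (v : V) : Subgroup (GraphAut G) where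
  carrier := {g | g v = v}
  one_mem' := rfl
  mul_mem' := by
    intro g h hg hh
    change g (h v) = v
    rw [show h v = v from hh]; exact hg
  inv_mem' := by
    intro g hg
    change g.symm v = v
    exact (RelIso.symm_apply_eq g).mpr (show g v = v from hg).symm

/-- The (setwise) stabilizer of an edge in the automorphism group of a graph. -/
def GraphAut.edgeStab {V : Type*} {G : SimpleGraph V} (e : Sym2 V) : Subgroup (GraphAut G) where
  carrier := {g | Sym2.map g e = e}
  one_mem' := by
    change Sym2.map id e = e
    simp
  mul_mem' := by
    intro g h hg hh
    have hg' : Sym2.map g e = e := hg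
    have hh' : Sym2.map h e = e := hh
    change Sym2.map (g ∘ h) e = e
    rw [← Sym2.map_map, hh', hg']
  inv_mem' := by
    intro g hg
    have hg' : Sym2.map g e = e := hg
    change Sym2.map g.symm e = e
    conv_lhs => rw [← hg']
    rw [Sym2.map_map, show (g.symm : V → V) ∘ g = id from funext g.symm_apply_apply]
    simp

/-- The subgroups of `Γ` that are stabilizers of a vertex or of an edge of the graph `G`, where `Γ`
acts on `G` through the homomorphism `φ`. -/
def IsCellStabilizer {A V : Type*} [Group A] {G : SimpleGraph V} (φ : A →* GraphAut G)
    (H : Subgroup A) : Prop :=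
  (∃ v : V, H = (GraphAut.vertexStab v).comap φ) ∨
    ∃ e ∈ G.edgeSet, H = (GraphAut.edgeStab e).comap φ

/-! ### Reducibility, irreducibility and anti-tori -/

section Product

variable {V₁ V₂ : Type*} {T₁ : SimpleGraph V₁} {T₂ : SimpleGraph V₂}

/-- The projection of `Γ` to the automorphism group of the first factor. -/
def prFst (Γ : Subgroup (GraphAut T₁ × GraphAut T₂)) : Γ →* GraphAut T₁ :=
  (MonoidHom.fst (GraphAut T₁) (GraphAut T₂)).comp Γ.subtype

/-- The projection of `Γ` to the automorphism group of the second factor. -/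
def prSnd (Γ : Subgroup (GraphAut T₁ × GraphAut T₂)) : Γ →* GraphAut T₂ :=
  (MonoidHom.snd (GraphAut T₁) (GraphAut T₂)).comp Γ.subtype

/-- One of the projections of `Γ` to the factors has discrete image. -/
def HasDiscreteProjection (Γ : Subgroup (GraphAut T₁ × GraphAut T₂)) : Prop :=
  DiscreteTopology (prFst Γ).range ∨ DiscreteTopology (prSnd Γ).range

/-- Some stabilizer in `Γ` of a vertex or an edge of one of the factors is weakly separable. -/
def HasWeaklySeparableStabilizer (Γ : Subgroup (GraphAut T₁ × GraphAut T₂)) : Prop :=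
  ∃ H : Subgroup Γ, (IsCellStabilizer (prFst Γ) H ∨ IsCellStabilizer (prSnd Γ) H) ∧
    H.IsWeaklySeparable

/-- All stabilizers in `Γ` of vertices and edges of the factors are separable. -/
def HasSeparableStabilizers (Γ : Subgroup (GraphAut T₁ × GraphAut T₂)) : Prop :=
  ∀ H : Subgroup Γ, (IsCellStabilizer (prFst Γ) H ∨ IsCellStabilizer (prSnd Γ) H) →
    H.IsSeparableSubgroup

/-- `K₁ = {g | (g, 1) ∈ Γ}`. -/
def factorFst (Γ : Subgroup (GraphAut T₁ × GraphAut T₂)) : Subgroup (GraphAut T₁) :=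
  Γ.comap (MonoidHom.inl (GraphAut T₁) (GraphAut T₂))

/-- `K₂ = {g | (1, g) ∈ Γ}`. -/
def factorSnd (Γ : Subgroup (GraphAut T₁ × GraphAut T₂)) : Subgroup (GraphAut T₂) :=
  Γ.comap (MonoidHom.inr (GraphAut T₁) (GraphAut T₂))

/-- The groups `K₁` and `K₂` act cocompactly on the factors and `K₁ × K₂` has finite index
in `Γ`. -/
def IsVirtuallyProduct (Γ : Subgroup (GraphAut T₁ × GraphAut T₂)) : Prop :=
  IsCocompactOn (factorFst Γ) ∧ IsCocompactOn (factorSnd Γ) ∧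
    (((factorFst Γ).prod (factorSnd Γ)).subgroupOf Γ).FiniteIndex

/-- `Γ` is reducible if any of the four (classically equivalent) conditions above holds. -/
def IsReducibleGroup (Γ : Subgroup (GraphAut T₁ × GraphAut T₂)) : Prop :=
  HasDiscreteProjection Γ ∨ HasWeaklySeparableStabilizer Γ ∨ HasSeparableStabilizers Γ ∨
    IsVirtuallyProduct Γ

/-- `Γ` is irreducible if it is not reducible. -/
def IsIrreducibleGroup (Γ : Subgroup (GraphAut T₁ × GraphAut T₂)) : Prop :=
  ¬ IsReducibleGroup Γ

/-- The image of a subset of the product of the geometric realizations under an automorphism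
preserving the factors. -/
def imageProd (g : GraphAut T₁ × GraphAut T₂) (S : Set (GeomPoint T₁ × GeomPoint T₂)) :
    Set (GeomPoint T₁ × GeomPoint T₂) :=
  (fun x => (g.1.mapPoint x.1, g.2.mapPoint x.2)) '' S

/-- The pair `g₁, g₂` is an anti-torus in `Γ`. -/
structure IsAntiTorus (Γ : Subgroup (GraphAut T₁ × GraphAut T₂))
    (g₁ g₂ : GraphAut T₁ × GraphAut T₂) : Prop where
  mem_fst : g₁ ∈ Γ
  mem_snd : g₂ ∈ Γ
  exists_lines : ∃ (p₁ : GeomPoint T₁) (p₂ : GeomPoint T₂)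
    (ℓ₁ : Set (GeomPoint T₁)) (ℓ₂ : Set (GeomPoint T₂)),
    IsGeodesicLine T₁ ℓ₁ ∧ IsGeodesicLine T₂ ℓ₂ ∧ p₁ ∈ ℓ₁ ∧ p₂ ∈ ℓ₂ ∧
      imageProd g₁ (ℓ₁ ×ˢ {p₂}) = ℓ₁ ×ˢ {p₂} ∧ imageProd g₂ ({p₁} ×ˢ ℓ₂) = {p₁} ×ˢ ℓ₂
  not_commute : ∀ m n : ℤ, m ≠ 0 → n ≠ 0 → ¬ Commute (g₁ ^ m) (g₂ ^ n)

end Product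

/-!
The invariant lines of an anti-torus `g₁, g₂` are used only through two consequences: `g₁` fixes
the point `p₂` of the second tree and `g₂` fixes the point `p₁` of the first one. As the trees are
locally finite, `g₁` therefore has finite orbits of vertices in the second tree, and `g₂` in the
first one (`HasFiniteOrbits.of_mapPoint_eq`).

Since `Γ` is discrete, it acts properly on the product (`actsProperly_of_discreteTopology`). Hence,
if `h` is a power of `g₂` whose conjugates by all powers of `g₁` move some vertex of the first tree
only within a finite set, there are finitely many such conjugates, so two of them coincide and a
nonzero power of `g₁` commutes with `h` (`ActsProperly.exists_zpow_commute`). For an anti-torus this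
is impossible, and each kind of reducibility provides such an `h` with nonzero exponent, possibly
after exchanging the two trees and the roles of `g₁` and `g₂`.

* If the projection to the first tree is discrete, or if `K₁ × K₂` has finite index, then a nonzero
  power of `g₂` acts trivially on the first tree, and so do all its conjugates.
* Suppose that the stabilizer `H` of a cell of the first tree is weakly separable. Local finiteness
  makes `H` commensurated. Removing finitely many coset representatives by means of virtually
  normal subgroups containing `H`, one finds a normal subgroup `N` of `Γ` such that `N ∩ H` has
  finite index in `H` and is normalized by `g₁` (`Subgroup.IsWeaklySeparable.exists_conj_mem`). A nonzero
  power of `g₂` lies in `N ∩ H`, and all its conjugates by powers of `g₁` stabilize the cell.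
* Separable subgroups are weakly separable, because a subgroup of finite index contains a normal
  one of finite index.
-/

/-! ### Automorphisms with finite orbits -/

/-- If automorphisms of a connected locally finite graph move one vertex only within a finite set,
they move every vertex only within a finite set. -/
lemma finite_setOf_apply_of_connected {V : Type*} {G : SimpleGraph V} [G.LocallyFinite]
    (hG : G.Connected) {F : Set V} (hF : F.Finite) (u s : V) :
    {p | ∃ g : GraphAut G, g u ∈ F ∧ g s = p}.Finite := by
  have hus := (SimpleGraph.reachable_iff_reflTransGen u s).mp (hG u s)
  induction hus with
  | refl => exact hF.subset fun p ⟨g, hg, hp⟩ => hp ▸ hg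
  | tail _ hadj ih =>
    refine (ih.biUnion fun p _ => (G.neighborSet p).toFinite).subset ?_
    rintro _ ⟨g, hg, rfl⟩
    exact Set.mem_biUnion (⟨g, hg, rfl⟩ : _ ∈ {p | ∃ g : GraphAut G, g u ∈ F ∧ g _ = p})
      (g.map_rel_iff.mpr hadj)

/-- An automorphism has finite orbits if the cyclic group it generates has only finite orbits of
vertices. -/
def HasFiniteOrbits {V : Type*} {G : SimpleGraph V} (g : GraphAut G) : Prop :=
  ∀ v, {p | ∃ k : ℤ, (g ^ k) v = p}.Finite

lemma HasFiniteOrbits.of_forall_mem {V : Type*} {G : SimpleGraph V} [G.LocallyFinite]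
    (hG : G.Connected) {g : GraphAut G} {F : Set V} (hF : F.Finite) {u : V}
    (h : ∀ k : ℤ, (g ^ k) u ∈ F) : HasFiniteOrbits g := fun v =>
  (finite_setOf_apply_of_connected hG hF u v).subset fun _ ⟨k, hk⟩ => ⟨g ^ k, h k, hk⟩

lemma pow_apply_eq_of_apply_eq {V : Type*} {G : SimpleGraph V} {g : GraphAut G} {v : V}
    (h : g v = v) (n : ℕ) : (g ^ n) v = v := by
  induction n with
  | zero => rfl
  | succ n ih => rw [pow_succ, RelIso.mul_apply, h, ih]

lemma HasFiniteOrbits.exists_pow_apply_eq {V : Type*} {G : SimpleGraph V} {g : GraphAut G}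
    (hg : HasFiniteOrbits g) (v : V) : ∃ n : ℕ, 0 < n ∧ (g ^ n) v = v := by
  have := (hg v).to_subtype
  obtain ⟨k, l, hkl, heq⟩ := Finite.exists_ne_map_eq_of_infinite
    (fun k : ℕ => (⟨(g ^ k) v, k, by rw [zpow_natCast]⟩ : {p | ∃ k : ℤ, (g ^ k) v = p}))
  replace heq : (g ^ k) v = (g ^ l) v := congrArg Subtype.val heq
  wlog hlt : k < l generalizing k l
  · exact this l k hkl.symm heq.symm (by omega)
  refine ⟨l - k, by omega, (g ^ k).injective ?_⟩
  rw [← RelIso.mul_apply, ← pow_add, Nat.add_sub_cancel' hlt.le, heq]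

lemma HasFiniteOrbits.exists_pow_forall_apply_eq {V : Type*} {G : SimpleGraph V} {g : GraphAut G}
    (hg : HasFiniteOrbits g) {S : Set V} (hS : S.Finite) :
    ∃ n : ℕ, 0 < n ∧ ∀ v ∈ S, (g ^ n) v = v := by
  induction S, hS using Set.Finite.induction_on with
  | empty => exact ⟨1, one_pos, by simp⟩
  | @insert a S _ _ ih =>
    obtain ⟨n, hn, h⟩ := ih
    obtain ⟨m, hm, h'⟩ := hg.exists_pow_apply_eq a
    refine ⟨m * n, Nat.mul_pos hm hn, ?_⟩
    rintro v (rfl | hv)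
    · rw [pow_mul]
      exact pow_apply_eq_of_apply_eq h' n
    · rw [mul_comm, pow_mul]
      exact pow_apply_eq_of_apply_eq (h v hv) m

/-- The support of a point of the geometric realization is a nonempty finite set, and it is
preserved by every automorphism fixing that point. -/
lemma HasFiniteOrbits.of_mapPoint_eq {V : Type*} {G : SimpleGraph V} [G.LocallyFinite]
    (hG : G.Connected) {g : GraphAut G} {p : GeomPoint G} (h : g.mapPoint p = p) :
    HasFiniteOrbits g := by
  have hfin : (Function.support p.coord).Finite := by
    obtain ⟨a, b, -, hs⟩ := p.support_simplex
    exact (Set.toFinite {a, b}).subset hs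
  obtain ⟨u, hu⟩ : (Function.support p.coord).Nonempty := by
    by_contra hne
    rw [Set.not_nonempty_iff_eq_empty, Function.support_eq_empty_iff] at hne
    simpa [hne] using p.sum_eq_one
  have hc : ∀ v, p.coord (g v) = p.coord v := fun v => by
    conv_lhs => rw [← h]
    exact congrArg p.coord (g.symm_apply_apply v)
  have hci : ∀ v, p.coord (g⁻¹ v) = p.coord v := fun v => by
    rw [← hc, RelIso.apply_inv_self]
  have hk : ∀ k : ℤ, ∀ v, p.coord ((g ^ k) v) = p.coord v := fun k => by
    induction k with
    | zero => exact fun v => rfl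
    | succ k ih => exact fun v => by rw [zpow_add_one, RelIso.mul_apply, ih, hc]
    | pred k ih => exact fun v => by rw [zpow_sub_one, RelIso.mul_apply, ih, hci]
  exact .of_forall_mem hG hfin fun k => by
    rw [Function.mem_support, hk k u]
    exact hu

/-! ### Discreteness -/

lemma GraphAut.exists_finite_of_mem_nhds_one {V : Type*} {G : SimpleGraph V}
    {U : Set (GraphAut G)} (hU : U ∈ nhds 1) :
    ∃ S : Set V, S.Finite ∧ ∀ g : GraphAut G, (∀ v ∈ S, g v = v) → g ∈ U := by
  let : TopologicalSpace V := ⊥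
  have : DiscreteTopology V := ⟨rfl⟩
  rw [nhds_induced, Filter.mem_comap] at hU
  obtain ⟨W, hW, hWU⟩ := hU
  rw [nhds_pi, Filter.mem_pi] at hW
  obtain ⟨S, hS, t, ht, htW⟩ := hW
  exact ⟨S, hS, fun g hg => hWU (htW fun v hv => by
    change g v ∈ t v
    rw [hg v hv]
    exact mem_of_mem_nhds (ht v))⟩

lemma exists_finite_of_discreteTopology {V : Type*} {G : SimpleGraph V} (Γ : Subgroup (GraphAut G))
    (h : DiscreteTopology Γ) :
    ∃ S : Set V, S.Finite ∧ ∀ g ∈ Γ, (∀ v ∈ S, g v = v) → g = 1 := by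
  have h1 : ({1} : Set Γ) ∈ nhds 1 := (isOpen_discrete _).mem_nhds rfl
  rw [nhds_subtype, Filter.mem_comap] at h1
  obtain ⟨U, hU, hU1⟩ := h1
  obtain ⟨S, hS, hSU⟩ := GraphAut.exists_finite_of_mem_nhds_one hU
  exact ⟨S, hS, fun g hg hgS =>
    congrArg Subtype.val (hU1 (show (⟨g, hg⟩ : Γ) ∈ _ from hSU g hgS) : (⟨g, hg⟩ : Γ) = 1)⟩

section

variable {V₁ V₂ : Type*} {T₁ : SimpleGraph V₁} {T₂ : SimpleGraph V₂}

lemma exists_finite_of_discreteTopology_prod (Γ : Subgroup (GraphAut T₁ × GraphAut T₂))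
    (h : DiscreteTopology Γ) :
    ∃ (S₁ : Set V₁) (S₂ : Set V₂), S₁.Finite ∧ S₂.Finite ∧
      ∀ g ∈ Γ, (∀ v ∈ S₁, g.1 v = v) → (∀ v ∈ S₂, g.2 v = v) → g = 1 := by
  have h1 : ({1} : Set Γ) ∈ nhds 1 := (isOpen_discrete _).mem_nhds rfl
  rw [nhds_subtype, Filter.mem_comap] at h1
  obtain ⟨U, hU, hU1⟩ := h1
  obtain ⟨U₁, hU₁, U₂, hU₂, hUU⟩ := mem_nhds_prod_iff.mp hU
  obtain ⟨S₁, hS₁, hSU₁⟩ := GraphAut.exists_finite_of_mem_nhds_one hU₁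
  obtain ⟨S₂, hS₂, hSU₂⟩ := GraphAut.exists_finite_of_mem_nhds_one hU₂
  exact ⟨S₁, S₂, hS₁, hS₂, fun g hg hg₁ hg₂ =>
    congrArg Subtype.val (hU1 (show (⟨g, hg⟩ : Γ) ∈ _ from
      hUU ⟨hSU₁ _ hg₁, hSU₂ _ hg₂⟩) : (⟨g, hg⟩ : Γ) = 1)⟩

/-- A group acting on two graphs acts properly on their product: only finitely many elements move
a given pair of vertices into a given finite set. -/
def ActsProperly {A : Type*} [Group A] (φ₁ : A →* GraphAut T₁) (φ₂ : A →* GraphAut T₂) : Prop :=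
  ∀ (u₁ : V₁) (u₂ : V₂) (F₁ : Set V₁) (F₂ : Set V₂), F₁.Finite → F₂.Finite →
    {γ : A | φ₁ γ u₁ ∈ F₁ ∧ φ₂ γ u₂ ∈ F₂}.Finite

lemma ActsProperly.symm {A : Type*} [Group A] {φ₁ : A →* GraphAut T₁} {φ₂ : A →* GraphAut T₂}
    (h : ActsProperly φ₁ φ₂) : ActsProperly φ₂ φ₁ := fun u₂ u₁ F₂ F₁ h₂ h₁ =>
  (h u₁ u₂ F₁ F₂ h₁ h₂).subset fun _ hγ => hγ.symm

lemma actsProperly_of_discreteTopology [T₁.LocallyFinite] [T₂.LocallyFinite] (hT₁ : T₁.Connected)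
    (hT₂ : T₂.Connected) (Γ : Subgroup (GraphAut T₁ × GraphAut T₂)) (h : DiscreteTopology Γ) :
    ActsProperly (prFst Γ) (prSnd Γ) := by
  intro u₁ u₂ F₁ F₂ hF₁ hF₂
  obtain ⟨S₁, S₂, hS₁, hS₂, hS⟩ := exists_finite_of_discreteTopology_prod Γ h
  have := hS₁.to_subtype
  have := hS₂.to_subtype
  -- An element is determined by its restriction to `S₁` and `S₂`, which takes finitely many values.
  let f : Γ → (S₁ → V₁) × (S₂ → V₂) := fun γ => (fun s => γ.1.1 s, fun s => γ.1.2 s)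
  refine Set.Finite.of_finite_image (f := f) ?_ ?_
  · refine ((Set.Finite.pi' fun s : S₁ => finite_setOf_apply_of_connected hT₁ hF₁ u₁ s.1).prod
      (Set.Finite.pi' fun s : S₂ => finite_setOf_apply_of_connected hT₂ hF₂ u₂ s.1)).subset ?_
    rintro _ ⟨γ, hγ, rfl⟩
    exact ⟨fun s => ⟨γ.1.1, hγ.1, rfl⟩, fun s => ⟨γ.1.2, hγ.2, rfl⟩⟩
  · intro γ _ δ _ hγδ
    have h₁ : ∀ s ∈ S₁, γ.1.1 s = δ.1.1 s := fun s hs => congrFun (congrArg Prod.fst hγδ) ⟨s, hs⟩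
    have h₂ : ∀ s ∈ S₂, γ.1.2 s = δ.1.2 s := fun s hs => congrFun (congrArg Prod.snd hγδ) ⟨s, hs⟩
    have : δ.1⁻¹ * γ.1 = 1 := by
      refine hS _ (Γ.mul_mem (Γ.inv_mem δ.2) γ.2) (fun s hs => ?_) fun s hs => ?_
      · exact (congrArg _ (h₁ s hs)).trans (RelIso.inv_apply_self δ.1.1 s)
      · exact (congrArg _ (h₂ s hs)).trans (RelIso.inv_apply_self δ.1.2 s)
    exact Subtype.ext (inv_mul_eq_one.mp this).symm

/-- If the conjugates of `h` by the powers of `g` move a vertex of the first factor only within a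
finite set, and `g` has finite orbits in the second factor, then a power of `g` commutes with `h`:
properness leaves only finitely many values for these conjugates. -/
lemma ActsProperly.exists_zpow_commute {A : Type*} [Group A] {φ₁ : A →* GraphAut T₁}
    {φ₂ : A →* GraphAut T₂} (hφ : ActsProperly φ₁ φ₂) {g h : A} (hg : HasFiniteOrbits (φ₂ g))
    (u₁ : V₁) (u₂ : V₂) {F : Set V₁} (hF : F.Finite)
    (hconj : ∀ k : ℤ, φ₁ (g ^ k * h * (g ^ k)⁻¹) u₁ ∈ F) : ∃ m : ℤ, m ≠ 0 ∧ Commute (g ^ m) h := by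
  let F₂ : Set V₂ := ⋃ p ∈ {p | ∃ k : ℤ, (φ₂ g ^ k) u₂ = p},
    {q | ∃ k : ℤ, (φ₂ g ^ k) (φ₂ h p) = q}
  have hF₂ : F₂.Finite := (hg u₂).biUnion fun p _ => hg _
  have := (hφ u₁ u₂ F F₂ hF hF₂).to_subtype
  have hmem : ∀ k : ℤ, g ^ k * h * (g ^ k)⁻¹ ∈ {γ : A | φ₁ γ u₁ ∈ F ∧ φ₂ γ u₂ ∈ F₂} := by
    refine fun k => ⟨hconj k, Set.mem_biUnion (x := (φ₂ g ^ (-k)) u₂) ⟨-k, rfl⟩ ⟨k, ?_⟩⟩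
    simp only [map_mul, map_inv, map_zpow, zpow_neg, RelIso.mul_apply]
  obtain ⟨k, l, hkl, heq⟩ := Finite.exists_ne_map_eq_of_infinite fun k : ℤ => Subtype.mk _ (hmem k)
  replace heq : g ^ k * h * (g ^ k)⁻¹ = g ^ l * h * (g ^ l)⁻¹ := congrArg Subtype.val heq
  refine ⟨k - l, sub_ne_zero.mpr hkl, ?_⟩
  rw [mul_inv_eq_iff_eq_mul] at heq
  rw [commute_iff_eq, sub_eq_neg_add, zpow_add, zpow_neg, mul_assoc, inv_mul_eq_iff_eq_mul, heq]
  simp only [mul_assoc]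

/-! ### Weakly separable subgroups -/

/-- Given finitely many elements outside `H`, some virtually normal subgroup containing `H` avoids
them all. The statement keeps only a normal subgroup `N` of finite index in it: `N` meets `r * H`
only for those `r ∈ R` that lie in `H`. -/
lemma Subgroup.IsWeaklySeparable.exists_normal {A : Type*} [Group A] {H : Subgroup A}
    (hH : H.IsWeaklySeparable) {R : Set A} (hR : R.Finite) :
    ∃ N : Subgroup A, N.Normal ∧ N.relIndex H ≠ 0 ∧ ∀ r ∈ R, ∀ h ∈ H, r * h ∈ N → r ∈ H := by
  obtain ⟨S, hS, rfl⟩ := hH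
  have key : ∀ r : R, ∃ N : Subgroup A, N.Normal ∧ N.relIndex (sInf S) ≠ 0 ∧
      ∀ h ∈ sInf S, r.1 * h ∈ N → r.1 ∈ sInf S := by
    intro r
    by_cases hr : r.1 ∈ sInf S
    · exact ⟨⊤, inferInstance, by simp, fun _ _ _ => hr⟩
    · rw [Subgroup.mem_sInf] at hr
      push Not at hr
      obtain ⟨K, hK, hrK⟩ := hr
      obtain ⟨N, hNK, hN, hfin⟩ := hS K hK
      refine ⟨N, hN, fun h0 => hfin.index_ne_zero ?_, fun h hh hrh => absurd ?_ hrK⟩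
      · exact Subgroup.relIndex_eq_zero_of_le_right (sInf_le hK) h0
      · exact (K.mul_mem_cancel_right (Subgroup.mem_sInf.mp hh K hK)).mp (hNK hrh)
  choose N hN hNH hNr using key
  have := hR.to_subtype
  refine ⟨⨅ r, N r, Subgroup.normal_iInf_normal hN, Subgroup.relIndex_iInf_ne_zero hNH,
    fun r hr h hh hrh => hNr ⟨r, hr⟩ h hh (Subgroup.mem_iInf.mp hrh ⟨r, hr⟩)⟩

/-- If a weakly separable subgroup `H` is commensurated by `g` (in the sense that finitely many
cosets of `H` cover each of its conjugates by `g` and `g⁻¹`), then some subgroup of finite index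
in `H` has all its conjugates by powers of `g` inside `H`. It is the intersection of `H` with a
normal subgroup that avoids the nontrivial ones among these cosets. -/
lemma Subgroup.IsWeaklySeparable.exists_conj_mem {A : Type*} [Group A] {H : Subgroup A}
    (hH : H.IsWeaklySeparable) {g : A}
    (hg : ∃ R : Set A, R.Finite ∧ ∀ h ∈ H, ∃ r ∈ R, r⁻¹ * (g * h * g⁻¹) ∈ H)
    (hg' : ∃ R : Set A, R.Finite ∧ ∀ h ∈ H, ∃ r ∈ R, r⁻¹ * (g⁻¹ * h * g) ∈ H) :
    ∃ N : Subgroup A, N.relIndex H ≠ 0 ∧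
      ∀ h ∈ N, h ∈ H → ∀ k : ℤ, g ^ k * h * (g ^ k)⁻¹ ∈ H := by
  obtain ⟨R, hR, hgR⟩ := hg
  obtain ⟨R', hR', hgR'⟩ := hg'
  obtain ⟨N, hN, hNH, hNR⟩ := hH.exists_normal (hR.union hR')
  have h₁ : ∀ h ∈ N, h ∈ H → g * h * g⁻¹ ∈ H := fun h hn hh => by
    obtain ⟨r, hr, hrH⟩ := hgR h hh
    have := hNR r (.inl hr) _ hrH (by simpa using hN.conj_mem h hn g)
    simpa using H.mul_mem this hrH
  have h₂ : ∀ h ∈ N, h ∈ H → g⁻¹ * h * g ∈ H := fun h hn hh => by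
    obtain ⟨r, hr, hrH⟩ := hgR' h hh
    have := hNR r (.inr hr) _ hrH (by simpa using hN.conj_mem h hn g⁻¹)
    simpa using H.mul_mem this hrH
  refine ⟨N, hNH, fun h hn hh k => ?_⟩
  induction k with
  | zero => simpa using hh
  | succ k ih =>
    convert h₁ _ (hN.conj_mem h hn _) ih using 1
    rw [zpow_add_one]
    group
  | pred k ih =>
    convert h₂ _ (hN.conj_mem h hn _) ih using 1
    rw [zpow_sub_one]
    group

lemma Subgroup.IsSeparableSubgroup.isWeaklySeparable {A : Type*} [Group A] {H : Subgroup A}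
    (hH : H.IsSeparableSubgroup) : H.IsWeaklySeparable := by
  obtain ⟨S, hS, rfl⟩ := hH
  refine ⟨S, fun K hK => ?_, rfl⟩
  have := hS K hK
  exact ⟨K.normalCore, K.normalCore_le, inferInstance, inferInstance⟩

/-! ### Cell stabilizers -/

/-- The stabilizer of a cell permutes its vertices and contains all elements fixing them. -/
lemma IsCellStabilizer.exists_vertices {A V : Type*} [Group A] {G : SimpleGraph V}
    {φ : A →* GraphAut G} {H : Subgroup A} (hH : IsCellStabilizer φ H) :
    ∃ v w : V, (∀ h ∈ H, φ h v ∈ ({v, w} : Set V) ∧ φ h w ∈ ({v, w} : Set V)) ∧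
      ∀ h, φ h v = v → φ h w = w → h ∈ H := by
  obtain ⟨v, rfl⟩ | ⟨e, -, rfl⟩ := hH
  · exact ⟨v, v, fun h hh => by
      have : φ h v = v := hh
      simp [this], fun h hv _ => hv⟩
  · induction e using Sym2.ind with
    | _ v w =>
      refine ⟨v, w, fun h hh => ?_, fun h hv hw => ?_⟩
      · have hh : Sym2.map (φ h) s(v, w) = s(v, w) := hh
        rw [Sym2.map_mk, Sym2.eq_iff] at hh
        obtain ⟨h1, h2⟩ | ⟨h1, h2⟩ := hh <;> simp [h1, h2]
      · change Sym2.map (φ h) s(v, w) = s(v, w)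
        simp [hv, hw]

/-- In a connected locally finite graph, cell stabilizers are commensurated. -/
lemma IsCellStabilizer.exists_finite_cover {A V : Type*} [Group A] {G : SimpleGraph V}
    [G.LocallyFinite] (hG : G.Connected) {φ : A →* GraphAut G} {H : Subgroup A}
    (hH : IsCellStabilizer φ H) (g : A) :
    ∃ R : Set A, R.Finite ∧ ∀ h ∈ H, ∃ r ∈ R, r⁻¹ * (g * h * g⁻¹) ∈ H := by
  obtain ⟨v, w, hHvw, hvwH⟩ := hH.exists_vertices
  let f : A → V × V := fun a => (φ a v, φ a w)
  let L : Set A := {a | ∃ h ∈ H, g * h * g⁻¹ = a}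
  have hL : (f '' L).Finite := by
    have hF : (Set.image (φ g) {v, w}).Finite := (Set.toFinite _).image _
    refine ((finite_setOf_apply_of_connected hG hF (φ g v) v).prod
      (finite_setOf_apply_of_connected hG hF (φ g v) w)).subset ?_
    rintro _ ⟨_, ⟨h, hh, rfl⟩, rfl⟩
    have : φ (g * h * g⁻¹) (φ g v) ∈ Set.image (φ g) {v, w} :=
      ⟨φ h v, (hHvw h hh).1, by simp [RelIso.mul_apply]⟩
    exact ⟨⟨_, this, rfl⟩, ⟨_, this, rfl⟩⟩
  obtain ⟨R, hRL, hR⟩ := Set.exists_subset_bijOn L f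
  refine ⟨R, Set.Finite.of_finite_image (by rwa [hR.image_eq]) hR.injOn, fun h hh => ?_⟩
  obtain ⟨r, hr, hrf⟩ := hR.surjOn ⟨g * h * g⁻¹, ⟨h, hh, rfl⟩, rfl⟩
  have h₁ : φ r v = φ (g * h * g⁻¹) v := congrArg Prod.fst hrf
  have h₂ : φ r w = φ (g * h * g⁻¹) w := congrArg Prod.snd hrf
  refine ⟨r, hr, hvwH _ ?_ ?_⟩
  · rw [map_mul, RelIso.mul_apply, ← h₁, map_inv, RelIso.inv_apply_self]
  · rw [map_mul, RelIso.mul_apply, ← h₂, map_inv, RelIso.inv_apply_self]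

/-! ### Commuting powers from reducibility -/

/-- If a power of `h` acts trivially on the first factor, some powers of `g` and `h` commute. -/
lemma ActsProperly.exists_zpow_commute_of_map_pow_eq_one {A : Type*} [Group A]
    {φ₁ : A →* GraphAut T₁} {φ₂ : A →* GraphAut T₂} [Nonempty V₁] [Nonempty V₂]
    (hφ : ActsProperly φ₁ φ₂) {g h : A} (hg : HasFiniteOrbits (φ₂ g)) {n : ℕ} (hn : 0 < n)
    (hh : φ₁ (h ^ n) = 1) : ∃ m n : ℤ, m ≠ 0 ∧ n ≠ 0 ∧ Commute (g ^ m) (h ^ n) := by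
  obtain ⟨u₁⟩ := ‹Nonempty V₁›
  obtain ⟨u₂⟩ := ‹Nonempty V₂›
  obtain ⟨m, hm, hc⟩ := hφ.exists_zpow_commute (h := h ^ n) hg u₁ u₂ (Set.finite_singleton u₁)
    fun k => by rw [map_mul, map_mul, hh, mul_one, ← map_mul, mul_inv_cancel, map_one]; rfl
  exact ⟨m, n, hm, by exact_mod_cast hn.ne', by rwa [zpow_natCast]⟩

lemma ActsProperly.exists_zpow_commute_of_discrete {A : Type*} [Group A]
    {φ₁ : A →* GraphAut T₁} {φ₂ : A →* GraphAut T₂} [Nonempty V₁] [Nonempty V₂]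
    (hφ : ActsProperly φ₁ φ₂) {g h : A} (hg : HasFiniteOrbits (φ₂ g)) (hh : HasFiniteOrbits (φ₁ h))
    (hd : DiscreteTopology φ₁.range) :
    ∃ m n : ℤ, m ≠ 0 ∧ n ≠ 0 ∧ Commute (g ^ m) (h ^ n) := by
  obtain ⟨S, hS, hS1⟩ := exists_finite_of_discreteTopology _ hd
  obtain ⟨n, hn, hnS⟩ := hh.exists_pow_forall_apply_eq hS
  rw [← map_pow] at hnS
  exact hφ.exists_zpow_commute_of_map_pow_eq_one hg hn (hS1 _ ⟨_, rfl⟩ hnS)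

lemma ActsProperly.exists_zpow_commute_of_isWeaklySeparable {A : Type*} [Group A]
    {φ₁ : A →* GraphAut T₁} {φ₂ : A →* GraphAut T₂} [T₁.LocallyFinite] (hT₁ : T₁.Connected)
    [Nonempty V₂] (hφ : ActsProperly φ₁ φ₂) {g h : A} (hg : HasFiniteOrbits (φ₂ g))
    (hh : HasFiniteOrbits (φ₁ h)) {H : Subgroup A} (hH : IsCellStabilizer φ₁ H)
    (hs : H.IsWeaklySeparable) :
    ∃ m n : ℤ, m ≠ 0 ∧ n ≠ 0 ∧ Commute (g ^ m) (h ^ n) := by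
  obtain ⟨u₂⟩ := ‹Nonempty V₂›
  obtain ⟨N, hNH, hN⟩ := hs.exists_conj_mem (hH.exists_finite_cover hT₁ g)
    (by simpa using hH.exists_finite_cover hT₁ g⁻¹)
  obtain ⟨v, w, hHvw, hvwH⟩ := hH.exists_vertices
  obtain ⟨n, hn, hnS⟩ := hh.exists_pow_forall_apply_eq (Set.toFinite {v, w})
  rw [← map_pow] at hnS
  have hnH : h ^ n ∈ H := hvwH _ (hnS v (by simp)) (hnS w (by simp))
  obtain ⟨l, hl, -, hlN⟩ := Subgroup.exists_pow_mem_of_relIndex_ne_zero hNH hnH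
  obtain ⟨m, hm, hc⟩ := hφ.exists_zpow_commute hg v u₂ (Set.toFinite {v, w})
    fun k => (hHvw _ (hN _ hlN.1 hlN.2 k)).1
  refine ⟨m, (n * l : ℕ), hm, by exact_mod_cast (Nat.mul_pos hn hl).ne', ?_⟩
  rwa [zpow_natCast, pow_mul]

/-- If the product of the factors has finite index in a discrete group `Γ`, a power of an element
with finite orbits in the first tree acts trivially on that tree. -/
lemma exists_pow_prFst_eq_one_of_finiteIndex {Γ : Subgroup (GraphAut T₁ × GraphAut T₂)}
    (hd : DiscreteTopology Γ)
    (hfin : (((factorFst Γ).prod (factorSnd Γ)).subgroupOf Γ).FiniteIndex) {h : Γ}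
    (hh : HasFiniteOrbits (prFst Γ h)) : ∃ n : ℕ, 0 < n ∧ prFst Γ (h ^ n) = 1 := by
  obtain ⟨S₁, S₂, hS₁, -, hS⟩ := exists_finite_of_discreteTopology_prod Γ hd
  obtain ⟨n, hn, -, hnK⟩ := Subgroup.exists_pow_mem_of_index_ne_zero hfin.index_ne_zero h
  obtain ⟨m, hm, hmS⟩ := hh.exists_pow_forall_apply_eq hS₁
  rw [← map_pow] at hmS
  refine ⟨m * n, Nat.mul_pos hm hn, ?_⟩
  have hK : prFst Γ (h ^ (m * n)) ∈ factorFst Γ := by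
    rw [mul_comm, pow_mul, map_pow]
    exact pow_mem (Subgroup.mem_prod.mp (Subgroup.mem_subgroupOf.mp hnK)).1 m
  refine congrArg Prod.fst (hS (prFst Γ (h ^ (m * n)), 1) hK (fun v hv => ?_) fun _ _ => rfl)
  change (prFst Γ (h ^ (m * n))) v = v
  rw [pow_mul, map_pow]
  exact pow_apply_eq_of_apply_eq (hmS v hv) n

end

theorem mainTheorem11 {V₁ V₂ : Type*} (T₁ : SimpleGraph V₁) (T₂ : SimpleGraph V₂)
    [T₁.LocallyFinite] [T₂.LocallyFinite] (hT₁ : T₁.IsTree) (hT₂ : T₂.IsTree)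
    (hdeg₁ : ∀ v, T₁.degree v ≠ 1) (hdeg₂ : ∀ v, T₂.degree v ≠ 1)
    (Γ : Subgroup (GraphAut T₁ × GraphAut T₂)) (hdisc : DiscreteTopology Γ)
    (hcoc : IsCocompactOnProd Γ)
    (hanti : ∃ g₁ g₂ : GraphAut T₁ × GraphAut T₂, IsAntiTorus Γ g₁ g₂) :
    IsIrreducibleGroup Γ := by
  obtain ⟨g₁, g₂, hg⟩ := hanti
  obtain ⟨p₁, p₂, ℓ₁, ℓ₂, -, -, hp₁, hp₂, hℓ₁, hℓ₂⟩ := hg.exists_lines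
  have hfix₁ : g₁.2.mapPoint p₂ = p₂ :=
    (hℓ₁.subset ⟨(p₁, p₂), ⟨hp₁, rfl⟩, rfl⟩).2
  have hfix₂ : g₂.1.mapPoint p₁ = p₁ :=
    (hℓ₂.subset ⟨(p₁, p₂), ⟨rfl, hp₂⟩, rfl⟩).1
  let γ₁ : Γ := ⟨g₁, hg.mem_fst⟩
  let γ₂ : Γ := ⟨g₂, hg.mem_snd⟩
  have h₁ : HasFiniteOrbits (prSnd Γ γ₁) := .of_mapPoint_eq hT₂.connected hfix₁
  have h₂ : HasFiniteOrbits (prFst Γ γ₂) := .of_mapPoint_eq hT₁.connected hfix₂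
  have hφ := actsProperly_of_discreteTopology hT₁.connected hT₂.connected Γ hdisc
  have := hT₁.connected.nonempty
  have := hT₂.connected.nonempty
  have hno : ¬ ∃ m n : ℤ, m ≠ 0 ∧ n ≠ 0 ∧ Commute (γ₁ ^ m) (γ₂ ^ n) := fun ⟨m, n, hm, hn, hc⟩ =>
    hg.not_commute m n hm hn (congrArg Subtype.val hc : (γ₁ ^ m * γ₂ ^ n).1 = _)
  have hno' : ¬ ∃ m n : ℤ, m ≠ 0 ∧ n ≠ 0 ∧ Commute (γ₂ ^ m) (γ₁ ^ n) := fun ⟨m, n, hm, hn, hc⟩ =>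
    hno ⟨n, m, hn, hm, hc.symm⟩
  have hweak : ¬ HasWeaklySeparableStabilizer Γ := by
    rintro ⟨H, hH | hH, hs⟩
    · exact hno (hφ.exists_zpow_commute_of_isWeaklySeparable hT₁.connected h₁ h₂ hH hs)
    · exact hno' (hφ.symm.exists_zpow_commute_of_isWeaklySeparable hT₂.connected h₂ h₁ hH hs)
  rintro ((hd | hd) | hw | hs | ⟨-, -, hfin⟩)
  · exact hno (hφ.exists_zpow_commute_of_discrete h₁ h₂ hd)
  · exact hno' (hφ.symm.exists_zpow_commute_of_discrete h₂ h₁ hd)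
  · exact hweak hw
  · obtain ⟨v⟩ := hT₁.connected.nonempty
    have hv : IsCellStabilizer (prFst Γ) ((GraphAut.vertexStab v).comap (prFst Γ)) :=
      .inl ⟨v, rfl⟩
    exact hweak ⟨_, .inl hv, (hs _ (.inl hv)).isWeaklySeparable⟩
  · obtain ⟨n, hn, hn1⟩ := exists_pow_prFst_eq_one_of_finiteIndex hdisc hfin h₂
    exact hno (hφ.exists_zpow_commute_of_map_pow_eq_one h₁ hn hn1)
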